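/- For nonnegative integers $t_1,\dots,t_n$, let $P'(t_1,\dots,t_n)$ denote the number of anagrams without fixed letters of the word $\underbrace{1\cdots1}_{t_1}\underbrace{2\cdots2}_{t_2}\cdots\underbrace{n\cdots n}_{t_n}$, that is, the number of distinct words containing each letter $i$ exactly $t_i$ times in which no position holds the letter that it holds in the original word. (The empty word counts as an anagram without fixed letters of itself, so $P'(0,\dots,0)=1$.) Let $(a_i)_{i=1}^n$ and $(b_i)_{i=1}^n$ be two sequences of nonnegative integers such that $(a_i)$ majorizes $(b_i)$: if $a_{[1]}\ge\dots\ge a_{[n]}$ and $b_{[1]}\ge\dots\ge b_{[n]}$ are their nonincreasing rearrangements, then $\sum_{i=1}^k a_{[i]}\ge\sum_{i=1}^k b_{[i]}$ for all $1\le k\le n$, and $\sum_{i=1}^n a_i=\sum_{i=1}^n b_i$. Then $$P'(a_1,\dots,a_n)\le P'(b_1,\dots,b_n).$$ -/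

import Mathlib

/-- The positions of the word `1…1 2…2 ⋯ n…n` with `t i` copies of the letter `i`:
the position `⟨i, j⟩` is the `j`-th place of the `i`-th block, so it holds the letter `i`. -/
abbrev WordPos {n : ℕ} (t : Fin n → ℕ) : Type := (i : Fin n) × Fin (t i)

/-- `w` is an anagram of the word with `t i` copies of each letter `i`: it assigns a letter to
every position, and every letter `i` is used exactly `t i` times. -/
def IsAnagram {n : ℕ} (t : Fin n → ℕ) (w : WordPos t → Fin n) : Prop :=
  ∀ i : Fin n, (Finset.univ.filter (fun p => w p = i)).card = t i

/-- An anagram without fixed letters: no position holds its original letter. -/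
def IsAFL {n : ℕ} (t : Fin n → ℕ) (w : WordPos t → Fin n) : Prop :=
  IsAnagram t w ∧ ∀ p : WordPos t, w p ≠ p.1

instance {n : ℕ} (t : Fin n → ℕ) (w : WordPos t → Fin n) : Decidable (IsAFL t w) :=
  inferInstanceAs (Decidable ((∀ i : Fin n, (Finset.univ.filter (fun p => w p = i)).card = t i) ∧
    ∀ p : WordPos t, w p ≠ p.1))

/-- The number `P'(t₁, …, tₙ)` of anagrams without fixed letters. -/
def numAFL {n : ℕ} (t : Fin n → ℕ) : ℕ :=
  (Finset.univ.filter (fun w : WordPos t → Fin n => IsAFL t w)).card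

/-- The rearrangement of a finite sequence in decreasing (nonincreasing) order. -/
def decreasingRearrangement {n : ℕ} (a : Fin n → ℕ) : Fin n → ℕ :=
  fun i => a (Tuple.sort a i.rev)

/-- `a` majorizes `b`: for each `k ≤ n`, the sum of the `k` largest terms of `a` is at least the
sum of the `k` largest terms of `b`, and the total sums agree. -/
def Majorizes {n : ℕ} (a b : Fin n → ℕ) : Prop :=
  (∀ k : ℕ, k ≤ n →
    ∑ i : Fin n with i.val < k, decreasingRearrangement b i ≤
      ∑ i : Fin n with i.val < k, decreasingRearrangement a i) ∧
  ∑ i, a i = ∑ i, b i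

open Finset

/-! `numAFL t` is the coefficient of `x^t` in `∏ i, (∑ j ≠ i, x_j)^(t i)`. Isolate two letters with
variables `x`, `y`, let `r` be the sum of the other variables, and expand the other blocks in powers
of `x + y`. The count becomes a sum of `pairCoeff m a b * D m`, where `D m ≥ 0` does not depend on
the multiplicities `a`, `b` of the two letters. So moving a unit from the larger to the smaller
multiplicity need only be checked on `pairCoeff` (`pairCoeff_le_transfer`). Such transfers link
majorized sequences. -/

/-! ### Two-letter coefficients and their transfer inequality -/

/-- The coefficients of `1 / (1 - x y - y z - z x - 2 x y z)`, defined by their recurrence. -/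
def pairCoeff : ℕ → ℕ → ℕ → ℕ
  | 0, a, b => if a = b then 1 else 0
  | m + 1, 0, b => if b = m + 1 then 1 else 0
  | m + 1, a + 1, 0 => if a = m then 1 else 0
  | m + 1, a + 1, b + 1 =>
      pairCoeff m (a + 1) b + pairCoeff m a (b + 1) + 2 * pairCoeff m a b + pairCoeff (m + 1) a b

theorem pairCoeff_zero_left (m b : ℕ) : pairCoeff m 0 b = if b = m then 1 else 0 := by
  cases m <;> simp [pairCoeff, eq_comm]

theorem pairCoeff_zero_right (m a : ℕ) : pairCoeff m a 0 = if a = m then 1 else 0 := by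
  cases m <;> cases a <;> simp [pairCoeff]

theorem pairCoeff_comm (m a b : ℕ) : pairCoeff m a b = pairCoeff m b a := by
  induction m generalizing a b with
  | zero => simp [pairCoeff, eq_comm]
  | succ m ihm =>
    induction a generalizing b with
    | zero => rw [pairCoeff_zero_left, pairCoeff_zero_right]
    | succ a iha =>
      cases b with
      | zero => rw [pairCoeff_zero_left, pairCoeff_zero_right]
      | succ b =>
        rw [pairCoeff, pairCoeff, ihm (a + 1) b, ihm a (b + 1), ihm a b, iha b]
        ring

/-- The recurrence has nonnegative coefficients, so the inequality passes through it term by term.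
-/
theorem pairCoeff_le_transfer (m a b : ℕ) (h : b + 1 ≤ a) :
    pairCoeff m (a + 1) b ≤ pairCoeff m a (b + 1) := by
  induction m generalizing a b with
  | zero =>
    rw [pairCoeff, if_neg (by omega)]
    exact Nat.zero_le _
  | succ m ihm =>
    induction b generalizing a with
    | zero =>
      obtain ⟨a, rfl⟩ : ∃ c, a = c + 1 := ⟨a - 1, by omega⟩
      rw [pairCoeff, pairCoeff, pairCoeff_zero_right m (a + 1)]
      omega
    | succ b ihb =>
      obtain ⟨a, rfl⟩ : ∃ c, a = c + 1 := ⟨a - 1, by omega⟩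
      rw [pairCoeff, pairCoeff]
      have h₁ := ihm (a + 1) b (by omega)
      have h₂ : pairCoeff m (a + 1) (b + 1) ≤ pairCoeff m a (b + 1 + 1) := by
        -- The induction hypothesis just fails at `a = b + 1`, where symmetry gives equality.
        rcases Nat.lt_or_ge a (b + 2) with hlt | hge
        · obtain rfl : a = b + 1 := by omega
          exact (pairCoeff_comm _ _ _).le
        · exact ihm a (b + 1) hge
      have h₃ := ihm a b (by omega)
      have h₄ := ihb a (by omega)
      omega

/-! ### Extraction of two-variable coefficients -/

section Bivariate

open Polynomial

variable {A : Type*} [CommSemiring A]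

theorem coeff_coeff_pair (r : A) (m a b : ℕ) :
    (((X + C (C r)) ^ a * (C X + C (C r)) ^ b * (C X + X) ^ m : A[X][X]).coeff b).coeff a =
      (pairCoeff m a b : A) * r ^ m := by
  have left (m b : ℕ) :
      (((X + C (C r)) ^ 0 * (C X + C (C r)) ^ b * (C X + X) ^ m : A[X][X]).coeff b).coeff 0 =
        (pairCoeff m 0 b : A) * r ^ m := by
    have key : ((((X + C (C r)) ^ 0 * (C X + C (C r)) ^ b * (C X + X) ^ m : A[X][X]).map
        (constantCoeff : A[X] →+* A)).coeff b) = (pairCoeff m 0 b : A) * r ^ m := by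
      simp only [Polynomial.map_mul, Polynomial.map_pow, Polynomial.map_add, map_X, map_C,
        constantCoeff_apply, coeff_X_zero, coeff_C_zero, map_zero, zero_add, pow_zero, one_mul]
      rw [← C_pow, coeff_C_mul, coeff_X_pow, pairCoeff_zero_left]
      split_ifs with h <;> simp [h]
    rwa [coeff_map] at key
  have right (m a : ℕ) :
      (((X + C (C r)) ^ a * (C X + C (C r)) ^ 0 * (C X + X) ^ m : A[X][X]).coeff 0).coeff a =
        (pairCoeff m a 0 : A) * r ^ m := by
    rw [← constantCoeff_apply]
    simp only [map_mul, map_pow, map_add, constantCoeff_apply, coeff_X_zero, coeff_C_zero,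
      zero_add, add_zero, pow_zero, mul_one]
    rw [← C_pow, coeff_C_mul, coeff_X_pow, pairCoeff_zero_right]
    split_ifs with h <;> simp [h]
  induction m generalizing a b with
  | zero =>
    have h : ((X + C (C r)) ^ a * (C X + C (C r)) ^ b * (C X + X) ^ 0 : A[X][X]) =
        (X + C (C r)) ^ a * C ((X + C r) ^ b) := by simp
    rw [h, coeff_mul_C, coeff_X_add_C_pow, ← C_pow, mul_assoc, coeff_C_mul, ← C_eq_natCast,
      coeff_C_mul, coeff_X_add_C_pow, pairCoeff]
    rcases lt_trichotomy a b with hlt | rfl | hlt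
    · simp [Nat.choose_eq_zero_of_lt hlt, hlt.ne]
    · simp
    · simp [Nat.choose_eq_zero_of_lt hlt, hlt.ne']
  | succ m ihm =>
    induction a generalizing b with
    | zero => exact left _ _
    | succ a iha =>
      cases b with
      | zero => exact right _ _
      | succ b =>
        -- This is `(y+r)(x+r)(x+y) = ry(y+r) + rx(x+r) + 2rxy + xy(x+y)`, the source of the
        -- recurrence.
        have key : ((X + C (C r)) ^ (a + 1) * (C X + C (C r)) ^ (b + 1) * (C X + X) ^ (m + 1) :
              A[X][X]) =
            C (C r) * (X * ((X + C (C r)) ^ (a + 1) * (C X + C (C r)) ^ b * (C X + X) ^ m)) +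
            C (C r) * (C X * ((X + C (C r)) ^ a * (C X + C (C r)) ^ (b + 1) * (C X + X) ^ m)) +
            C (C (2 * r)) * (C X * (X * ((X + C (C r)) ^ a * (C X + C (C r)) ^ b *
              (C X + X) ^ m))) +
            C X * (X * ((X + C (C r)) ^ a * (C X + C (C r)) ^ b * (C X + X) ^ (m + 1))) := by
          simp only [C_mul, C_ofNat]
          ring
        rw [key]
        simp only [coeff_add, coeff_C_mul, coeff_X_mul, ihm, iha, pairCoeff]
        push_cast
        ring

end Bivariate

/-! ### Anagrams as polynomial coefficients -/

section Coefficients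

open MvPolynomial

variable {n : ℕ}

/-- The generating polynomial of the words avoiding the letter `i` on the `i`-th block. -/
noncomputable def avoidingPoly (t : Fin n → ℕ) : MvPolynomial (Fin n) ℕ :=
  ∏ i, (∑ j with j ≠ i, X j) ^ t i

theorem numAFL_eq_coeff (t : Fin n → ℕ) :
    numAFL t = (avoidingPoly t).coeff (Finsupp.equivFunOnFinite.symm t) := by
  have h : avoidingPoly t = ∏ p : WordPos t, ∑ j with j ≠ p.1, X j := by
    rw [Fintype.prod_sigma]
    simp [avoidingPoly]
  have hmon (w : WordPos t → Fin n) :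
      ∏ p, (X (w p) : MvPolynomial (Fin n) ℕ) = monomial (∑ p, Finsupp.single (w p) 1) 1 := by
    rw [monomial_sum_one]
    rfl
  rw [h, prod_univ_sum, coeff_sum]
  simp only [hmon, coeff_monomial]
  rw [sum_boole, Nat.cast_id, numAFL]
  congr 1
  ext w
  have hcount : ∑ p, Finsupp.single (w p) 1 = Finsupp.equivFunOnFinite.symm t ↔ IsAnagram t w := by
    rw [Finsupp.ext_iff]
    refine forall_congr' fun i => ?_
    simp [Finsupp.finsetSum_apply, Finsupp.single_apply]
  rw [mem_filter, mem_filter, hcount, Fintype.mem_piFinset]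
  simp [IsAFL, and_comm]

theorem numAFL_comp_perm (t : Fin n → ℕ) (σ : Equiv.Perm (Fin n)) :
    numAFL (t ∘ σ) = numAFL t := by
  have h : rename σ (avoidingPoly (t ∘ σ)) = avoidingPoly t := by
    simp only [avoidingPoly, map_prod, map_pow, map_sum, rename_X]
    refine Fintype.prod_equiv σ _ _ fun i => ?_
    congr 1
    exact sum_equiv σ (by simp) (by simp)
  rw [numAFL_eq_coeff, numAFL_eq_coeff, ← h,
    ← coeff_rename_mapDomain σ σ.injective]
  congr 1
  ext i
  obtain ⟨j, rfl⟩ := σ.surjective i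
  rw [Finsupp.mapDomain_apply σ.injective]
  rfl

/-- Splits off the variables `p` and `q` as the inner and outer variable of `A[X][Y]`. -/
noncomputable def splitVars (p q : Fin n) :
    MvPolynomial (Fin n) ℕ →+* Polynomial (Polynomial (MvPolynomial (Fin n) ℕ)) :=
  (aeval fun j => if j = p then Polynomial.C Polynomial.X else if j = q then Polynomial.X
    else Polynomial.C (Polynomial.C (X j))).toRingHom

theorem splitVars_X (p q j : Fin n) :
    splitVars p q (X j) = if j = p then Polynomial.C Polynomial.X else if j = q then Polynomial.X
    else Polynomial.C (Polynomial.C (X j)) :=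
  aeval_X _ _

theorem splitVars_monomial {p q : Fin n} (hpq : p ≠ q) (s : Fin n →₀ ℕ) :
    splitVars p q (monomial s 1) = Polynomial.monomial (s q) (Polynomial.monomial (s p)
      (monomial ((s.erase p).erase q) 1)) := by
  induction s using Finsupp.induction_linear with
  | zero => simp
  | add f g hf hg =>
    rw [← one_mul (1 : ℕ), ← monomial_mul, map_mul, hf, hg, Polynomial.monomial_mul_monomial,
      Polynomial.monomial_mul_monomial, monomial_mul]
    simp [Finsupp.erase_add]
  | single j k =>
    rw [← X_pow_eq_monomial, map_pow, splitVars_X]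
    split_ifs with h₁ h₂
    · subst h₁
      simp [hpq, ← Polynomial.C_pow, Polynomial.X_pow_eq_monomial]
    · subst h₂
      simp [hpq.symm, Polynomial.X_pow_eq_monomial]
    · simp [h₁, h₂, ← Polynomial.C_pow, X_pow_eq_monomial]

theorem coeff_splitVars {p q : Fin n} (hpq : p ≠ q) (F : MvPolynomial (Fin n) ℕ)
    (s : Fin n →₀ ℕ) :
    (((splitVars p q F).coeff (s q)).coeff (s p)).coeff ((s.erase p).erase q) = F.coeff s := by
  induction F using MvPolynomial.induction_on' with
  | monomial u c =>
    have hc : monomial u c = c • (monomial u 1 : MvPolynomial (Fin n) ℕ) := by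
      rw [smul_monomial, smul_eq_mul, mul_one]
    have hs : u = s ↔ u q = s q ∧ u p = s p ∧ (u.erase p).erase q = (s.erase p).erase q := by
      refine ⟨by rintro rfl; simp, fun ⟨h₁, h₂, h₃⟩ => Finsupp.ext fun j => ?_⟩
      by_cases hjp : j = p
      · rw [hjp, h₂]
      by_cases hjq : j = q
      · rw [hjq, h₁]
      · simpa [Finsupp.erase_ne, hjp, hjq] using DFunLike.congr_fun h₃ j
    rw [hc, map_nsmul, splitVars_monomial hpq]
    rw [Polynomial.coeff_smul, Polynomial.coeff_smul, coeff_smul, coeff_smul, coeff_monomial,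
      Polynomial.coeff_monomial]
    congr 1
    by_cases h₁ : u q = s q
    · by_cases h₂ : u p = s p
      · simp [hs, h₁, h₂, coeff_monomial]
      · simp [hs, h₁, h₂, Polynomial.coeff_monomial]
    · simp [hs, h₁]
  | add F G hF hG => simp [hF, hG]

/-- What matters is that `s` and `D` are chosen before `u`: they see `t` only off `p` and `q`. -/
theorem numAFL_eq_sum_pairCoeff {p q : Fin n} (hpq : p ≠ q) (t : Fin n → ℕ) :
    ∃ (s : Finset ℕ) (D : ℕ → ℕ), ∀ u : Fin n → ℕ, (∀ j, j ≠ p → j ≠ q → u j = t j) →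
      numAFL u = ∑ m ∈ s, pairCoeff m (u p) (u q) * D m := by
  set R : MvPolynomial (Fin n) ℕ := ∑ j with j ≠ p ∧ j ≠ q, X j with hR
  set Q : Polynomial (MvPolynomial (Fin n) ℕ) :=
    ∏ i with i ≠ p ∧ i ≠ q, (Polynomial.X + Polynomial.C (∑ j with j ≠ p ∧ j ≠ q ∧ j ≠ i, X j)) ^ t i
    with hQ
  set e : Fin n →₀ ℕ := ((Finsupp.equivFunOnFinite.symm t).erase p).erase q with he
  refine ⟨range (Q.natDegree + 1), fun m => (R ^ m * Q.coeff m).coeff e, fun u hu => ?_⟩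
  have heu : ((Finsupp.equivFunOnFinite.symm u).erase p).erase q = e := by
    ext j
    by_cases h₁ : j = p <;> by_cases h₂ : j = q <;> simp_all
  have hfactor : splitVars p q (avoidingPoly u) =
      (Polynomial.X + Polynomial.C (Polynomial.C R)) ^ u p *
      (Polynomial.C Polynomial.X + Polynomial.C (Polynomial.C R)) ^ u q *
      Q.eval₂ (Polynomial.C.comp Polynomial.C) (Polynomial.C Polynomial.X + Polynomial.X) := by
    have hfilter : univ.filter (fun i : Fin n => i ≠ p ∧ i ≠ q) = (univ.erase p).erase q := by
      ext i
      simp [and_comm]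
    have hX : ∀ j, j ≠ p → j ≠ q → splitVars p q (X j) = Polynomial.C (Polynomial.C (X j)) :=
      fun j h₁ h₂ => by rw [splitVars_X, if_neg h₁, if_neg h₂]
    have hXp : splitVars p q (X p) = Polynomial.C Polynomial.X := by
      rw [splitVars_X, if_pos rfl]
    have hXq : splitVars p q (X q) = Polynomial.X := by
      rw [splitVars_X, if_neg hpq.symm, if_pos rfl]
    have hp : splitVars p q (∑ j with j ≠ p, X j) =
        Polynomial.X + Polynomial.C (Polynomial.C R) := by
      rw [← add_sum_erase _ _ (show q ∈ univ.filter (· ≠ p) by simp [hpq.symm]), map_add, hXq, hR]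
      simp only [map_sum]
      congr 1
      refine sum_congr (by ext; simp [and_comm]) fun j hj => ?_
      simp only [mem_filter, mem_univ, true_and] at hj
      exact hX j hj.1 hj.2
    have hq : splitVars p q (∑ j with j ≠ q, X j) =
        Polynomial.C Polynomial.X + Polynomial.C (Polynomial.C R) := by
      rw [← add_sum_erase _ _ (show p ∈ univ.filter (· ≠ q) by simp [hpq]), map_add, hXp, hR]
      simp only [map_sum]
      congr 1
      refine sum_congr (by ext; simp) fun j hj => ?_
      simp only [mem_filter, mem_univ, true_and] at hj
      exact hX j hj.1 hj.2
    have hother (i : Fin n) (hip : i ≠ p) (hiq : i ≠ q) : splitVars p q (∑ j with j ≠ i, X j) =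
        Polynomial.C Polynomial.X + Polynomial.X +
          Polynomial.C (Polynomial.C (∑ j with j ≠ p ∧ j ≠ q ∧ j ≠ i, X j)) := by
      rw [← add_sum_erase _ _ (show p ∈ univ.filter (· ≠ i) by simp [hip.symm]),
        ← add_sum_erase _ _ (show q ∈ (univ.filter (· ≠ i)).erase p by simp [hpq.symm, hiq.symm]),
        map_add, map_add, hXp, hXq, ← add_assoc]
      simp only [map_sum]
      congr 1
      refine sum_congr (by ext; simp; tauto) fun j hj => ?_
      simp only [mem_filter, mem_univ, true_and] at hj
      exact hX j hj.1 hj.2.1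
    have heval (P : Polynomial (MvPolynomial (Fin n) ℕ)) :
        P.eval₂ (Polynomial.C.comp Polynomial.C) (Polynomial.C Polynomial.X + Polynomial.X) =
          Polynomial.eval₂RingHom (Polynomial.C.comp Polynomial.C)
            (Polynomial.C Polynomial.X + Polynomial.X) P := rfl
    rw [avoidingPoly, ← mul_prod_erase univ _ (mem_univ p),
      ← mul_prod_erase (univ.erase p) _ (show q ∈ univ.erase p by simp [hpq.symm]), ← hfilter,
      ← mul_assoc, map_mul, map_mul, map_pow, map_pow, hp, hq, hQ,
      heval, map_prod, map_prod]
    congr 1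
    refine prod_congr rfl fun i hi => ?_
    simp only [mem_filter, mem_univ, true_and] at hi
    rw [map_pow, hother i hi.1 hi.2, hu i hi.1 hi.2, map_pow, map_add,
      Polynomial.coe_eval₂RingHom, Polynomial.eval₂_X, Polynomial.eval₂_C]
    rfl
  rw [numAFL_eq_coeff, ← coeff_splitVars hpq, heu, hfactor, Polynomial.eval₂_eq_sum_range, mul_sum]
  simp only [Polynomial.finsetSum_coeff, coeff_sum]
  refine sum_congr rfl fun m _ => ?_
  have hcomm (P S : Polynomial (Polynomial (MvPolynomial (Fin n) ℕ))) :
      P * ((Polynomial.C.comp Polynomial.C) (Q.coeff m) * S) =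
        Polynomial.C (Polynomial.C (Q.coeff m)) * (P * S) := by
    rw [RingHom.comp_apply]
    ring
  rw [hcomm, Polynomial.coeff_C_mul, Polynomial.coeff_C_mul, Finsupp.equivFunOnFinite_symm_apply_apply,
    Finsupp.equivFunOnFinite_symm_apply_apply, coeff_coeff_pair, mul_left_comm, ← nsmul_eq_mul,
    coeff_smul, smul_eq_mul, mul_comm (Q.coeff m)]

theorem numAFL_le_transfer {p q : Fin n} (hpq : p ≠ q) (t u : Fin n → ℕ)
    (hu : ∀ j, j ≠ p → j ≠ q → u j = t j) (hp : t p = u p + 1) (hq : u q = t q + 1) (h : t q < u p) :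
    numAFL t ≤ numAFL u := by
  obtain ⟨s, D, hD⟩ := numAFL_eq_sum_pairCoeff hpq t
  rw [hD t fun _ _ _ => rfl, hD u hu]
  refine sum_le_sum fun m _ => Nat.mul_le_mul_right _ ?_
  rw [hp, hq]
  exact pairCoeff_le_transfer m _ _ h

end Coefficients

/-! ### Majorization through unit transfers -/

section Majorization

variable {n : ℕ}

/-- Each transfer lowers `∑ (a i - b i)` (truncated). Only `b` need be sorted, so `a` is never
re-sorted. -/
theorem le_of_antitone_of_partialSums_le (f : (Fin n → ℕ) → ℕ)
    (hf : ∀ (p q : Fin n) (t u : Fin n → ℕ), p ≠ q → (∀ j, j ≠ p → j ≠ q → u j = t j) →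
      t p = u p + 1 → u q = t q + 1 → t q < u p → f t ≤ f u)
    (a b : Fin n → ℕ) (hb : Antitone b)
    (hle : ∀ k ≤ n, ∑ i with i.val < k, b i ≤ ∑ i with i.val < k, a i)
    (hsum : ∑ i, a i = ∑ i, b i) : f a ≤ f b := by
  induction hd : ∑ i, (a i - b i) using Nat.strong_induction_on generalizing a with
  | _ d ih =>
  by_cases hlt : ∃ q, a q < b q
  swap
  · push Not at hlt
    have hba := (sum_eq_sum_iff_of_le fun i _ => hlt i).1 hsum.symm
    exact (congrArg f (funext fun i => (hba i (mem_univ i)).symm)).le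
  obtain ⟨q, hq, hqmin⟩ : ∃ q, a q < b q ∧ ∀ i < q, b i ≤ a i := by
    obtain ⟨q, hq⟩ := hlt
    obtain ⟨m, hm⟩ := (univ.filter fun i => a i < b i).exists_minimal ⟨q, by simpa using hq⟩
    refine ⟨m, by simpa using hm.1, fun i hi => ?_⟩
    by_contra! hc
    exact hm.not_lt (by simpa using hc) hi
  obtain ⟨p, hpq, hp⟩ : ∃ p < q, b p < a p := by
    by_contra! hc
    refine (hle (q + 1) q.isLt).not_gt (sum_lt_sum (fun i hi => ?_) ⟨q, by simp, hq⟩)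
    rcases eq_or_ne i q with rfl | hne
    · exact hq.le
    · exact hc i (lt_of_le_of_ne (Nat.lt_succ_iff.1 (by simpa using hi)) hne)
  have hbpq : b q ≤ b p := hb hpq.le
  set u : Fin n → ℕ := Function.update (Function.update a p (a p - 1)) q (a q + 1) with hu
  have hup : u p = a p - 1 := by simp [hu, hpq.ne]
  have huq : u q = a q + 1 := by simp [hu]
  have hune : ∀ j, j ≠ p → j ≠ q → u j = a j := fun j h₁ h₂ => by simp [hu, h₁, h₂]
  have hbal (s : Finset (Fin n)) :
      ∑ i ∈ s, u i + (if p ∈ s then 1 else 0) = ∑ i ∈ s, a i + (if q ∈ s then 1 else 0) := by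
    rw [← sum_ite_eq s p fun _ => 1, ← sum_ite_eq s q fun _ => 1, ← sum_add_distrib,
      ← sum_add_distrib]
    refine sum_congr rfl fun i _ => ?_
    rcases eq_or_ne p i with rfl | h₁
    · rw [hup, if_pos rfl, if_neg hpq.ne']
      omega
    rcases eq_or_ne q i with rfl | h₂
    · rw [huq, if_pos rfl, if_neg h₁, add_zero]
    · rw [hune i h₁.symm h₂.symm, if_neg h₁, if_neg h₂]
  -- The transfer is admissible because `a q < b q ≤ b p < a p`.
  refine (hf p q a u hpq.ne hune (by omega) huq (by omega)).trans (ih _ ?_ u ?_ ?_ rfl)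
  · rw [← hd]
    refine sum_lt_sum (fun i _ => ?_) ⟨p, mem_univ p, by omega⟩
    rcases eq_or_ne i p with rfl | h₁
    · omega
    rcases eq_or_ne i q with rfl | h₂
    · omega
    · rw [hune i h₁ h₂]
  · intro k hk
    have hk₁ := hbal (univ.filter fun i => i.val < k)
    simp only [mem_filter, mem_univ, true_and] at hk₁
    have hk₂ := hle k hk
    by_cases hpk : p.val < k
    · by_cases hqk : q.val < k
      · rw [if_pos hpk, if_pos hqk] at hk₁
        omega
      · have hlt : ∑ i with i.val < k, b i < ∑ i with i.val < k, a i := by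
          refine sum_lt_sum (fun i hi => hqmin i ?_) ⟨p, by simpa using hpk, hp⟩
          have : i.val < k := by simpa using hi
          exact Fin.lt_def.2 (by omega)
        rw [if_pos hpk, if_neg hqk] at hk₁
        omega
    · rw [if_neg hpk] at hk₁
      omega
  · have := hbal univ
    simp only [mem_univ, if_true] at this
    omega

end Majorization

theorem theorem4p3 (n : ℕ) (a b : Fin n → ℕ) (hab : Majorizes a b) :
    numAFL a ≤ numAFL b := by
  have hperm (c : Fin n → ℕ) :
      decreasingRearrangement c = c ∘ (Fin.revPerm.trans (Tuple.sort c)) := rfl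
  have hanti : Antitone (decreasingRearrangement b) := fun i j hij =>
    Tuple.monotone_sort b (Fin.rev_le_rev.mpr hij)
  have key := le_of_antitone_of_partialSums_le numAFL
    (fun p q t u hpq hu hp hq h => numAFL_le_transfer hpq t u hu hp hq h)
    (decreasingRearrangement a) (decreasingRearrangement b) hanti hab.1 (by
      rw [hperm, hperm]
      simp only [Function.comp_apply, Equiv.sum_comp]
      exact hab.2)
  rwa [hperm a, hperm b, numAFL_comp_perm, numAFL_comp_perm] at key
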